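/- Let $\Sigma_t=\mathrm{diag}(F_t)+A\,\mathrm{diag}(V_t)A'$, $t\ge 0$, where $A=(a_{kl})$ is a deterministic orthogonal $2\times2$ matrix and, for $l=1,2$ and $X\in\{F,V\}$, the process $X^{(l)}$ is the Ornstein–Uhlenbeck process $$dX^{(l)}_t=-\lambda_{X,l}X^{(l)}_t\,dt+dZ^{(X,l)}_{\lambda_{X,l}t}$$ with deterministic initial value $X^{(l)}_0$ and $\lambda_{X,l}>0$. The four processes $Z^{(F,1)},Z^{(F,2)},Z^{(V,1)},Z^{(V,2)}$ are independent inverse Gaussian subordinators, $E_{\mathcal Q}\,e^{i\theta Z^{(X,l)}_t}=e^{t\Psi_{X,l}(\theta)}$ with $$\Psi_{X,l}(\theta)=-a_{X,l}\left(\sqrt{-2i\theta+b_{X,l}^2}-b_{X,l}\right),\qquad a_{X,l},b_{X,l}>0 .$$ Let $\Sigma^+_t=\int_0^t\Sigma_s\,ds$, with entries $\sigma^{jk+}_t$, and for $\theta\in\mathbb R$ put $$I_X^{(l)}(\theta)=\int_0^{\lambda_{X,l}t}\Psi_{X,l}\!\left(\lambda_{X,l}^{-1}\theta(1-e^{-\lambda_{X,l}t+s})\right)ds,\qquad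 m_{X,l}=\lambda_{X,l}^{-1}(1-e^{-\lambda_{X,l}t})X_0^{(l)} .$$ Write $\partial I$ and $\partial^2 I$ for the first and second derivative of $I$ at $\theta=0$. Then, for every $t\ge0$, the functions $I_X^{(l)}$ are twice continuously differentiable near $0$, with $$\partial I_X^{(l)}=\frac{i\,a_{X,l}}{\lambda_{X,l}b_{X,l}}\left(\lambda_{X,l}t-(1-e^{-\lambda_{X,l}t})\right),$$ $$\partial^2 I_X^{(l)}=-\frac{a_{X,l}}{\lambda_{X,l}^2b_{X,l}^3}\left[\lambda_{X,l}t-2(1-e^{-\lambda_{X,l}t})+\tfrac12(1-e^{-2\lambda_{X,l}t})\right],$$ all entries of $\Sigma^+_t$ are square integrable, and, with $$D_k=i\,m_{F,k}+\partial I_F^{(k)}+i\sum_{l=1}^2a_{kl}^2m_{V,l}+\sum_{l=1}^2a_{kl}^2\,\partial I_V^{(l)},\qquad D_{12}=i\sum_{l=1}^2a_{1l}a_{2l}m_{V,l}+\sum_{l=1}^2a_{1l}a_{2l}\,\partial I_V^{(l)},$$ for $k=1,2$: $$E_{\mathcal Q}(\sigma^{kk+}_t)=m_{F,k}-i\,\partial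 I_F^{(k)}+\sum_{l=1}^2a_{kl}^2m_{V,l}-i\sum_{l=1}^2a_{kl}^2\,\partial I_V^{(l)},$$ $$E_{\mathcal Q}(\sigma^{12+}_t)=\sum_{l=1}^2a_{1l}a_{2l}m_{V,l}-i\sum_{l=1}^2a_{1l}a_{2l}\,\partial I_V^{(l)},$$ $$E_{\mathcal Q}[(\sigma^{kk+}_t)^2]=-D_k^2-\Big(\partial^2I_F^{(k)}+\sum_{l=1}^2a_{kl}^4\,\partial^2I_V^{(l)}\Big),$$ $$E_{\mathcal Q}[(\sigma^{12+}_t)^2]=-\sum_{l=1}^2a_{1l}^2a_{2l}^2\,\partial^2I_V^{(l)}-D_{12}^2,$$ $$E_{\mathcal Q}[\sigma^{kk+}_t\sigma^{12+}_t]=-\sum_{l=1}^2a_{kl}^2a_{1l}a_{2l}\,\partial^2I_V^{(l)}-D_kD_{12},$$ $$E_{\mathcal Q}[\sigma^{11+}_t\sigma^{22+}_t]=-\sum_{l=1}^2a_{1l}^2a_{2l}^2\,\partial^2I_V^{(l)}-D_1D_2 .$$ -/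

import Mathlib

open MeasureTheory ProbabilityTheory Filter Topology
open scoped NNReal

noncomputable section

/-- Right-continuous with left limits, for functions of time `t ≥ 0`. -/
def IsCadlagPath (f : ℝ≥0 → ℝ) : Prop :=
  ∀ t, ContinuousWithinAt f (Set.Ici t) t ∧ ∃ x, Tendsto f (𝓝[<] t) (𝓝 x)

/-- A real-valued Lévy process started at zero. -/
structure IsLevyProcess {Ω : Type*} [MeasurableSpace Ω] (Z : ℝ≥0 → Ω → ℝ) (Q : Measure Ω) :
    Prop where
  measurable : ∀ t, Measurable (Z t)
  zero : ∀ᵐ ω ∂Q, Z 0 ω = 0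
  indep_increments : HasIndepIncrements Z Q
  stationary_increments : ∀ s h : ℝ≥0,
    IdentDistrib (fun ω => Z (s + h) ω - Z s ω) (fun ω => Z h ω - Z 0 ω) Q Q
  cadlag : ∀ᵐ ω ∂Q, IsCadlagPath (fun t => Z t ω)

/-- The inverse Gaussian characteristic exponent `Ψ(θ) = -a (√(-2iθ + b²) - b)`, with the principal
square root. -/
def igExponent (a b θ : ℝ) : ℂ :=
  -(a : ℂ) * ((-2 * Complex.I * (θ : ℂ) + (b : ℂ) ^ 2) ^ (1 / 2 : ℂ) - (b : ℂ))

/-- An inverse Gaussian subordinator: a Lévy process with nondecreasing paths and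
`E exp(iθ Z_t) = exp(t Ψ(θ))`. -/
structure IsIGSubordinator {Ω : Type*} [MeasurableSpace Ω] (a b : ℝ) (Z : ℝ≥0 → Ω → ℝ)
    (Q : Measure Ω) : Prop extends IsLevyProcess Z Q where
  mono : ∀ᵐ ω ∂Q, Monotone (fun t => Z t ω)
  charFun_eq : ∀ (t : ℝ≥0) (θ : ℝ),
    charFun (Q.map (Z t)) θ = Complex.exp ((t : ℂ) * igExponent a b θ)

/-- The parameters of one inverse Gaussian Ornstein-Uhlenbeck factor: the mean reversion rate, the
inverse Gaussian parameters of the driving subordinator and the deterministic initial value. -/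
structure IGOUParams where
  lam : ℝ
  a : ℝ
  b : ℝ
  x0 : ℝ
  lam_pos : 0 < lam
  a_pos : 0 < a
  b_pos : 0 < b

/-- `X` solves `dX_t = -lam X_t dt + dZ_{lam t}`, `X_0 = x0`. Since the noise is additive, this is
the pathwise equation `X_t = x0 - lam ∫₀ᵗ X_s ds + (Z_{lam t} - Z_0)`. -/
structure IsOUProcess {Ω : Type*} [MeasurableSpace Ω] (lam x0 : ℝ) (Z X : ℝ≥0 → Ω → ℝ)
    (Q : Measure Ω) : Prop where
  measurable : ∀ t, Measurable (X t)
  eqn : ∀ᵐ ω ∂Q, ∀ t : ℝ≥0,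
    IntervalIntegrable (fun s : ℝ => X s.toNNReal ω) volume 0 t ∧
    X t ω = x0 - lam * (∫ s in (0 : ℝ)..t, X s.toNNReal ω)
      + (Z (lam * t).toNNReal ω - Z 0 ω)

/-- The covariance process `Σ_t = diag(F_t) + A diag(V_t) A'`. -/
def covProcess {Ω : Type*} (A : Matrix (Fin 2) (Fin 2) ℝ) (F V : Fin 2 → ℝ≥0 → Ω → ℝ)
    (t : ℝ≥0) (ω : Ω) : Matrix (Fin 2) (Fin 2) ℝ :=
  Matrix.diagonal (fun l => F l t ω) + A * Matrix.diagonal (fun l => V l t ω) * A.transpose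

/-- The entry `(j, k)` of the integrated covariance process `Σ⁺_t = ∫₀ᵗ Σ_s ds`. -/
def intCov {Ω : Type*} (A : Matrix (Fin 2) (Fin 2) ℝ) (F V : Fin 2 → ℝ≥0 → Ω → ℝ)
    (t : ℝ≥0) (j k : Fin 2) (ω : Ω) : ℝ :=
  ∫ s in (0 : ℝ)..t, covProcess A F V s.toNNReal ω j k

/-- The contribution `lam⁻¹ (1 - exp(-lam t)) x0` of the initial value to the integrated factor. -/
def IGOUParams.init (p : IGOUParams) (t : ℝ≥0) : ℝ :=
  p.lam⁻¹ * (1 - Real.exp (-(p.lam * t))) * p.x0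

/-- `I(lam t, θ) = ∫₀^{lam t} Ψ(lam⁻¹ θ (1 - exp(-lam t + s))) ds`, the contribution of the
subordinator to the log characteristic function of the integrated factor. -/
def IGOUParams.logChf (p : IGOUParams) (t : ℝ≥0) (θ : ℝ) : ℂ :=
  ∫ s in (0 : ℝ)..(p.lam * t),
    igExponent p.a p.b (p.lam⁻¹ * θ * (1 - Real.exp (-(p.lam * t) + s)))

/-- The first derivative of `I(lam t, θ)` in `θ`, at zero. -/
def IGOUParams.D1 (p : IGOUParams) (t : ℝ≥0) : ℂ := deriv (p.logChf t) 0

/-- The second derivative of `I(lam t, θ)` in `θ`, at zero. -/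
def IGOUParams.D2 (p : IGOUParams) (t : ℝ≥0) : ℂ := iteratedDeriv 2 (p.logChf t) 0

end

/-! Every entry of `Σ⁺_t` is almost surely a linear combination of the four integrated factors `Y =
∫₀ᵗ X_s ds`. The subordinators are independent, so these factors are uncorrelated, and the moments
of the entries depend only on the mean and variance of each `Y` (`moments_sum_mul_of_uncorrelated`).
What has to be shown is `E Y = m - i ∂I` and `Var Y = -∂²I`.

No characteristic function of `Y` is computed; both sides are evaluated explicitly. The integrating
factor `exp(lam s)` turns the Ornstein-Uhlenbeck equation into `Y = m + ∫₀ᵗ exp(-lam (t - s)) Z_{lam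
s} ds` (`integral_ouPath`). By Fubini, the mean and variance of `Y` are integrals of `E Z_s = s a/b`
and `cov(Z_s, Z_u) = min(s, u) a/b³`. The first is read off the derivatives of the characteristic
function at zero, the second follows from independent increments. Square integrability of `Z_s` is
not assumed: it follows from the smoothness of the characteristic function
(`memLp_two_of_contDiff_charFun`).

On the other side, differentiating `I` under the integral sign gives the integrals of `1 - exp(-lam
t + s)` and of its square, with the same closed forms. -/

/-! ### Derivatives of the inverse Gaussian exponent -/

theorem contDiff_two_of_hasDerivAt {f f' f'' : ℝ → ℂ} (h₁ : ∀ x, HasDerivAt f (f' x) x)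
    (h₂ : ∀ x, HasDerivAt f' (f'' x) x) (hc : Continuous f'') :
    ContDiff ℝ 2 f ∧ deriv f = f' ∧ iteratedDeriv 2 f = f'' := by
  have e₁ : deriv f = f' := funext fun x => (h₁ x).deriv
  have e₂ : deriv f' = f'' := funext fun x => (h₂ x).deriv
  refine ⟨?_, e₁, ?_⟩
  · rw [show (2 : WithTop ℕ∞) = 1 + 1 by norm_num, contDiff_succ_iff_deriv, e₁,
      contDiff_one_iff_deriv, e₂]
    exact ⟨fun x => (h₁ x).differentiableAt, by simp, fun x => (h₂ x).differentiableAt, hc⟩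
  · rw [iteratedDeriv_succ, iteratedDeriv_one, e₁, e₂]

/-- The quantity under the square root in the inverse Gaussian exponent lies in the slit plane. -/
theorem igBase_mem_slitPlane {b : ℝ} (hb : 0 < b) (θ : ℝ) :
    -2 * Complex.I * (θ : ℂ) + (b : ℂ) ^ 2 ∈ Complex.slitPlane := by
  left
  have : (-2 * Complex.I * (θ : ℂ) + (b : ℂ) ^ 2).re = b ^ 2 := by
    simp [← Complex.ofReal_pow]
  rw [this]
  positivity

theorem hasDerivAt_igBase_cpow {b : ℝ} (hb : 0 < b) (c : ℂ) (θ : ℝ) :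
    HasDerivAt (fun θ : ℝ => (-2 * Complex.I * (θ : ℂ) + (b : ℂ) ^ 2) ^ c)
      (c * (-2 * Complex.I * (θ : ℂ) + (b : ℂ) ^ 2) ^ (c - 1) * (-2 * Complex.I)) θ := by
  have h : HasDerivAt (fun z : ℂ => -2 * Complex.I * z + (b : ℂ) ^ 2) (-2 * Complex.I) (θ : ℂ) := by
    simpa using ((hasDerivAt_id (θ : ℂ)).const_mul (-2 * Complex.I)).add_const ((b : ℂ) ^ 2)
  exact (h.cpow_const (igBase_mem_slitPlane hb θ)).comp_ofReal

theorem continuous_igBase_cpow {b : ℝ} (hb : 0 < b) (c : ℂ) :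
    Continuous (fun θ : ℝ => (-2 * Complex.I * (θ : ℂ) + (b : ℂ) ^ 2) ^ c) :=
  continuous_iff_continuousAt.2 fun θ => (hasDerivAt_igBase_cpow hb c θ).continuousAt

theorem hasDerivAt_igExponent {b : ℝ} (a : ℝ) (hb : 0 < b) (θ : ℝ) :
    HasDerivAt (igExponent a b)
      (a * Complex.I * (-2 * Complex.I * (θ : ℂ) + (b : ℂ) ^ 2) ^ (-(1 / 2) : ℂ)) θ := by
  convert! ((hasDerivAt_igBase_cpow hb (1 / 2) θ).sub_const (b : ℂ)).const_mul (-(a : ℂ)) using 1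
  rw [show (1 / 2 - 1 : ℂ) = -(1 / 2) by norm_num]
  ring

theorem hasDerivAt_deriv_igExponent {b : ℝ} (a : ℝ) (hb : 0 < b) (θ : ℝ) :
    HasDerivAt
      (fun θ : ℝ => a * Complex.I * (-2 * Complex.I * (θ : ℂ) + (b : ℂ) ^ 2) ^ (-(1 / 2) : ℂ))
      (-a * (-2 * Complex.I * (θ : ℂ) + (b : ℂ) ^ 2) ^ (-(3 / 2) : ℂ)) θ := by
  convert! (hasDerivAt_igBase_cpow hb (-(1 / 2)) θ).const_mul (a * Complex.I) using 1
  rw [show (-(1 / 2) - 1 : ℂ) = -(3 / 2) by norm_num]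
  linear_combination (-(a : ℂ) * (-2 * Complex.I * (θ : ℂ) + (b : ℂ) ^ 2) ^ (-(3 / 2) : ℂ)) *
    Complex.I_mul_I

theorem igBase_zero_cpow_neg_half {b : ℝ} (hb : 0 < b) :
    (-2 * Complex.I * ((0 : ℝ) : ℂ) + (b : ℂ) ^ 2) ^ (-(1 / 2) : ℂ) = 1 / b := by
  have : (-2 * Complex.I * ((0 : ℝ) : ℂ) + (b : ℂ) ^ 2) = ((b ^ 2 : ℝ) : ℂ) := by simp
  rw [this, show (-(1 / 2) : ℂ) = ((-(1 / 2) : ℝ) : ℂ) by simp,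
    ← Complex.ofReal_cpow (by positivity), ← Real.rpow_natCast_mul hb.le]
  norm_num [Real.rpow_neg_one]

theorem igBase_zero_cpow_neg_three_half {b : ℝ} (hb : 0 < b) :
    (-2 * Complex.I * ((0 : ℝ) : ℂ) + (b : ℂ) ^ 2) ^ (-(3 / 2) : ℂ) = 1 / b ^ 3 := by
  have : (-2 * Complex.I * ((0 : ℝ) : ℂ) + (b : ℂ) ^ 2) = ((b ^ 2 : ℝ) : ℂ) := by simp
  rw [this, show (-(3 / 2) : ℂ) = ((-(3 / 2) : ℝ) : ℂ) by simp,
    ← Complex.ofReal_cpow (by positivity), ← Real.rpow_natCast_mul hb.le]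
  norm_num [Real.rpow_neg hb.le]

theorem igExponent_zero {b : ℝ} (a : ℝ) (hb : 0 < b) : igExponent a b 0 = 0 := by
  have : (-2 * Complex.I * ((0 : ℝ) : ℂ) + (b : ℂ) ^ 2) = ((b ^ 2 : ℝ) : ℂ) := by simp
  rw [igExponent, this, show (1 / 2 : ℂ) = ((1 / 2 : ℝ) : ℂ) by simp,
    ← Complex.ofReal_cpow (by positivity), ← Real.rpow_natCast_mul hb.le]
  norm_num

/-- Differentiation of an integral of rescalings of a function. -/
theorem hasDerivAt_integral_comp_mul {w : ℝ → ℂ} {g : ℝ → ℝ} {ψ ψ' : ℝ → ℂ} (hw : Continuous w)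
    (hg : Continuous g) (hψ : ∀ x, HasDerivAt ψ (ψ' x) x) (hψ' : Continuous ψ') (a b θ : ℝ) :
    HasDerivAt (fun θ => ∫ s in a..b, w s * ψ (θ * g s))
      (∫ s in a..b, w s * g s * ψ' (θ * g s)) θ := by
  have hψc : Continuous ψ := continuous_iff_continuousAt.2 fun x => (hψ x).continuousAt
  have hF' : Continuous fun p : ℝ × ℝ => w p.2 * g p.2 * ψ' (p.1 * g p.2) := by fun_prop
  -- The `θ`-derivative of the integrand is jointly continuous, so compactness yields a constant
  -- dominating function.
  obtain ⟨C, hC⟩ := ((isCompact_closedBall θ 1).prod (isCompact_uIcc (a := a)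
    (b := b))).exists_bound_of_continuousOn hF'.continuousOn
  refine (intervalIntegral.hasDerivAt_integral_of_dominated_loc_of_deriv_le (bound := fun _ => C)
    (F := fun θ s => w s * ψ (θ * g s)) (F' := fun θ s => w s * g s * ψ' (θ * g s))
    (Metric.closedBall_mem_nhds θ one_pos) ?_ ?_ ?_ ?_ ?_ ?_).2
  · exact Eventually.of_forall fun x => by
      apply Continuous.aestronglyMeasurable; fun_prop
  · apply Continuous.intervalIntegrable; fun_prop
  · apply Continuous.aestronglyMeasurable; fun_prop
  · exact Eventually.of_forall fun s hs x hx => hC (x, s) ⟨hx, Set.uIoc_subset_uIcc hs⟩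
  · exact intervalIntegrable_const
  · refine Eventually.of_forall fun s _ x _ => ?_
    have h : HasDerivAt (fun x : ℝ => x * g s) (g s) x := by
      simpa using (hasDerivAt_id x).mul_const (g s)
    convert! ((hψ (x * g s)).scomp x h).const_mul (w s) using 1
    simp [mul_assoc]

/-! ### The function `I` and its derivatives at zero -/

section LogChf

variable (p : IGOUParams) (t : ℝ≥0)

theorem integral_one_sub_exp {l : ℝ} :
    ∫ s in (0 : ℝ)..l, (1 - Real.exp (-l + s)) = l - (1 - Real.exp (-l)) := by
  have h : ∀ s ∈ Set.uIcc 0 l, HasDerivAt (fun s => s - Real.exp (-l + s))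
      (1 - Real.exp (-l + s)) s := fun s _ => by
    convert! (hasDerivAt_id s).sub ((hasDerivAt_id s).const_add (-l)).exp using 1
    simp
  rw [intervalIntegral.integral_eq_sub_of_hasDerivAt h
    (by apply Continuous.intervalIntegrable; fun_prop)]
  simp
  ring

theorem integral_one_sub_exp_sq {l : ℝ} :
    ∫ s in (0 : ℝ)..l, (1 - Real.exp (-l + s)) ^ 2 =
      l - 2 * (1 - Real.exp (-l)) + 1 / 2 * (1 - Real.exp (-(2 * l))) := by
  have h : ∀ s ∈ Set.uIcc 0 l, HasDerivAt
      (fun s => s - 2 * Real.exp (-l + s) + 1 / 2 * (Real.exp (-l + s)) ^ 2)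
      ((1 - Real.exp (-l + s)) ^ 2) s := fun s _ => by
    have h1 : HasDerivAt (fun s => Real.exp (-l + s)) (Real.exp (-l + s)) s := by
      simpa using ((hasDerivAt_id s).const_add (-l)).exp
    convert! ((hasDerivAt_id s).sub (h1.const_mul 2)).add ((h1.pow 2).const_mul (1 / 2)) using 1
    simp
    ring
  rw [intervalIntegral.integral_eq_sub_of_hasDerivAt h
    (by apply Continuous.intervalIntegrable; fun_prop)]
  have : Real.exp (-(2 * l)) = Real.exp (-l) ^ 2 := by
    rw [← Real.exp_nat_mul]; congr 1; push_cast; ring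
  rw [this]
  simp
  ring

/-- The integrand is `Ψ(θ g(s))` with `g(s) = lam⁻¹ (1 - exp(-lam t + s))`. Each differentiation
brings out one factor `g(s)`, which joins the weight; at `θ = 0` only the integrals of `g` and `g²`
remain. -/
theorem IGOUParams.logChf_contDiff_aux :
    ContDiff ℝ 2 (p.logChf t) ∧
      deriv (p.logChf t) = (fun θ => ∫ s in (0 : ℝ)..(p.lam * t),
        ((p.lam⁻¹ * (1 - Real.exp (-(p.lam * t) + s)) : ℝ) : ℂ) * (p.a * Complex.I *
          (-2 * Complex.I * ((θ * (p.lam⁻¹ * (1 - Real.exp (-(p.lam * t) + s))) : ℝ) : ℂ)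
            + (p.b : ℂ) ^ 2) ^ (-(1 / 2) : ℂ))) ∧
      iteratedDeriv 2 (p.logChf t) = (fun θ => ∫ s in (0 : ℝ)..(p.lam * t),
        ((p.lam⁻¹ * (1 - Real.exp (-(p.lam * t) + s)) : ℝ) : ℂ) *
          ((p.lam⁻¹ * (1 - Real.exp (-(p.lam * t) + s)) : ℝ) : ℂ) * (-p.a *
          (-2 * Complex.I * ((θ * (p.lam⁻¹ * (1 - Real.exp (-(p.lam * t) + s))) : ℝ) : ℂ)
            + (p.b : ℂ) ^ 2) ^ (-(3 / 2) : ℂ))) := by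
  have hg : Continuous fun s : ℝ => p.lam⁻¹ * (1 - Real.exp (-(p.lam * t) + s)) := by fun_prop
  have hgc := Complex.continuous_ofReal.comp hg
  have c1 : Continuous fun θ : ℝ => p.a * Complex.I *
      (-2 * Complex.I * (θ : ℂ) + (p.b : ℂ) ^ 2) ^ (-(1 / 2) : ℂ) :=
    (continuous_igBase_cpow p.b_pos _).const_mul _
  have c2 : Continuous fun θ : ℝ => -(p.a : ℂ) *
      (-2 * Complex.I * (θ : ℂ) + (p.b : ℂ) ^ 2) ^ (-(3 / 2) : ℂ) :=
    (continuous_igBase_cpow p.b_pos _).const_mul _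
  apply contDiff_two_of_hasDerivAt
  · intro θ
    have := hasDerivAt_integral_comp_mul (w := fun _ => 1) continuous_const hg
      (hasDerivAt_igExponent p.a p.b_pos) c1 0 (p.lam * t) θ
    convert! this using 1
    · ext θ
      simp only [IGOUParams.logChf, one_mul]
      congr 1; ext s; congr 1; ring
    · simp only [one_mul]
  · intro θ
    exact hasDerivAt_integral_comp_mul hgc hg
      (hasDerivAt_deriv_igExponent p.a p.b_pos) c2 0 (p.lam * t) θ
  · apply intervalIntegral.continuous_parametric_intervalIntegral_of_continuous'
    have : Continuous fun q : ℝ × ℝ => q.1 * (p.lam⁻¹ * (1 - Real.exp (-(p.lam * t) + q.2))) := by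
      fun_prop
    exact ((hgc.mul hgc).comp continuous_snd).mul (c2.comp this)

theorem IGOUParams.contDiff_logChf : ContDiff ℝ 2 (p.logChf t) := (p.logChf_contDiff_aux t).1

theorem IGOUParams.D1_eq : p.D1 t = Complex.I * p.a / (p.lam * p.b) *
    (p.lam * t - (1 - Real.exp (-(p.lam * t))) : ℝ) := by
  rw [IGOUParams.D1, (p.logChf_contDiff_aux t).2.1]
  simp only [zero_mul, igBase_zero_cpow_neg_half p.b_pos]
  rw [intervalIntegral.integral_mul_const, intervalIntegral.integral_ofReal,
    intervalIntegral.integral_const_mul, integral_one_sub_exp]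
  push_cast
  have := p.lam_pos.ne'
  have := p.b_pos.ne'
  field_simp

theorem IGOUParams.D2_eq : p.D2 t = -((p.a : ℂ) / (p.lam ^ 2 * p.b ^ 3)) *
    (p.lam * t - 2 * (1 - Real.exp (-(p.lam * t)))
      + 1 / 2 * (1 - Real.exp (-(2 * (p.lam * t)))) : ℝ) := by
  rw [IGOUParams.D2, (p.logChf_contDiff_aux t).2.2]
  simp only [zero_mul, igBase_zero_cpow_neg_three_half p.b_pos, ← Complex.ofReal_mul]
  rw [intervalIntegral.integral_mul_const, intervalIntegral.integral_ofReal]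
  have : ∀ s, p.lam⁻¹ * (1 - Real.exp (-(p.lam * t) + s)) *
      (p.lam⁻¹ * (1 - Real.exp (-(p.lam * t) + s))) =
      (p.lam⁻¹) ^ 2 * (1 - Real.exp (-(p.lam * t) + s)) ^ 2 := fun s => by ring
  simp only [this]
  rw [intervalIntegral.integral_const_mul, integral_one_sub_exp_sq]
  push_cast
  have := p.lam_pos.ne'
  have := p.b_pos.ne'
  field_simp

end LogChf

/-! ### Moments from the characteristic function -/

/-- A probability measure on the line with a twice continuously differentiable characteristic
function has a finite second moment. -/
theorem memLp_two_of_contDiff_charFun {μ : Measure ℝ} [IsProbabilityMeasure μ]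
    (h : ContDiff ℝ 2 (charFun μ)) : MemLp id 2 μ := by
  set u : ℝ → ℝ := fun x => (charFun μ x).re with hu
  have huc : ContDiff ℝ 2 u := Complex.reCLM.contDiff.comp h
  have hue : ∀ x, u x = ∫ y, Real.cos (x * y) ∂μ := fun x => by
    have hre := integral_re (𝕜 := ℂ) (μ := μ) (f := fun y : ℝ => Complex.exp (x * y * Complex.I))
      (Integrable.of_bound (C := 1) (by fun_prop) (Eventually.of_forall fun y => by
        rw [← Complex.ofReal_mul, Complex.norm_exp_ofReal_mul_I]))
    simp only [hu, charFun_apply_real]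
    change _ = Complex.re _ at hre
    rw [← hre]
    congr 1; ext y
    rw [← Complex.ofReal_mul]
    exact Complex.exp_ofReal_mul_I_re _
  have hu0 : u 0 = 1 := by simp [hue]
  have hu1 : ∀ x, u x ≤ 1 := fun x => by
    have := norm_charFun_le_one (μ := μ) x
    exact (Complex.re_le_norm _).trans this
  -- The real part of the characteristic function is maximal at `0`, so its Taylor expansion there
  -- has no linear term and `1 - u x = O(x²)`.
  have hd : deriv u 0 = 0 := IsLocalMax.deriv_eq_zero <|
    Eventually.of_forall fun x => by rw [hu0]; exact hu1 x
  obtain ⟨C, hC⟩ := exists_taylor_mean_remainder_bound (f := u) (a := 0) (b := 1) (n := 1)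
    zero_le_one (by norm_num; exact huc.contDiffOn)
  have hC' : ∀ x ∈ Set.Icc (0 : ℝ) 1, 1 - u x ≤ C * x ^ 2 := fun x hx => by
    have := hC x hx
    rw [taylorWithinEval_succ, taylor_within_zero_eval, iteratedDerivWithin_one,
      (huc.differentiable (by norm_num) 0).derivWithin
        (uniqueDiffOn_Icc zero_lt_one 0 (by simp)), hd, hu0] at this
    have := neg_le_of_abs_le this
    norm_num at this
    linarith
  set ε : ℕ → ℝ := fun n => 1 / ((n : ℝ) + 1) with hε
  have hεpos : ∀ n, 0 < ε n := fun n => by positivity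
  have hε1 : ∀ n, ε n ≤ 1 := fun n => by
    rw [hε, div_le_one (by positivity)]; linarith [n.cast_nonneg (α := ℝ)]
  have hε0 : Tendsto ε atTop (𝓝 0) := tendsto_one_div_add_atTop_nhds_zero_nat
  -- Nonnegative functions converging pointwise to `x²`. Their integrals are `2 (1 - u ε) / ε² ≤ 2
  -- C`, so Fatou bounds the second moment.
  set f : ℕ → ℝ → ℝ := fun n x => 2 * (1 - Real.cos (ε n * x)) / (ε n) ^ 2 with hf
  have hfnn : ∀ n x, 0 ≤ f n x := fun n x =>
    div_nonneg (by linarith [Real.cos_le_one (ε n * x)]) (by positivity)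
  have hint : ∀ n, Integrable (f n) μ := fun n => by
    refine Integrable.of_bound (C := 4 / ε n ^ 2) (by apply Continuous.aestronglyMeasurable; fun_prop)
      (Eventually.of_forall fun x => ?_)
    rw [Real.norm_of_nonneg (hfnn n x)]
    simp only [hf]
    gcongr
    linarith [Real.neg_one_le_cos (ε n * x)]
  have hle : ∀ n, ∫⁻ x, ENNReal.ofReal (f n x) ∂μ ≤ ENNReal.ofReal (2 * C) := fun n => by
    rw [← ofReal_integral_eq_lintegral_ofReal (hint n) (Eventually.of_forall (hfnn n))]
    apply ENNReal.ofReal_le_ofReal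
    have : ∫ x, f n x ∂μ = 2 * (1 - u (ε n)) / (ε n) ^ 2 := by
      simp only [hf]
      rw [integral_div, integral_const_mul, integral_sub (integrable_const _), hue]
      · simp
      · exact Integrable.of_bound (C := 1) (by apply Continuous.aestronglyMeasurable; fun_prop)
          (Eventually.of_forall fun x => by simpa using Real.abs_cos_le_one _)
    rw [this, div_le_iff₀ (by have := hεpos n; positivity)]
    linarith [hC' (ε n) ⟨(hεpos n).le, hε1 n⟩]
  have hlim : ∀ x, Tendsto (fun n => ENNReal.ofReal (f n x)) atTop (𝓝 (ENNReal.ofReal (x ^ 2))) := by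
    intro x
    refine (ENNReal.continuous_ofReal.tendsto _).comp ?_
    -- The half-angle formula `1 - cos y = 2 sin² (y / 2)`; continuity of `sinc` at `0` then gives
    -- the limit.
    have e : ∀ n, f n x = (x * Real.sinc (ε n * x / 2)) ^ 2 := fun n => by
      rcases eq_or_ne x 0 with rfl | hx
      · simp [hf]
      · have h1 : Real.cos (ε n * x) = 1 - 2 * Real.sin (ε n * x / 2) ^ 2 := by
          have := Real.cos_two_mul (ε n * x / 2)
          have h2 := Real.sin_sq_add_cos_sq (ε n * x / 2)
          rw [show 2 * (ε n * x / 2) = ε n * x by ring] at this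
          linarith
        have := (hεpos n).ne'
        simp only [hf]
        rw [h1, Real.sinc_of_ne_zero (by positivity)]
        field_simp
        ring
    simp only [e]
    have : Tendsto (fun n => ε n * x / 2) atTop (𝓝 0) := by
      simpa using (hε0.mul_const x).div_const 2
    simpa using (((Real.continuous_sinc.tendsto 0).comp this).const_mul x).pow 2
  have hfatou : ∫⁻ x, ENNReal.ofReal (x ^ 2) ∂μ ≤ ENNReal.ofReal (2 * C) := by
    calc ∫⁻ x, ENNReal.ofReal (x ^ 2) ∂μ
        = ∫⁻ x, liminf (fun n => ENNReal.ofReal (f n x)) atTop ∂μ := by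
          congr 1; ext x; exact (hlim x).liminf_eq.symm
      _ ≤ liminf (fun n => ∫⁻ x, ENNReal.ofReal (f n x) ∂μ) atTop :=
          lintegral_liminf_le fun n => by
            apply Measurable.ennreal_ofReal; simp only [hf]; fun_prop
      _ ≤ ENNReal.ofReal (2 * C) := by
          refine liminf_le_of_le (by isBoundedDefault) fun b hb => ?_
          obtain ⟨n, hn⟩ := hb.exists
          exact hn.trans (hle n)
  rw [memLp_two_iff_integrable_sq (by fun_prop)]
  refine ⟨by fun_prop, ?_⟩
  rw [hasFiniteIntegral_iff_ofReal (Eventually.of_forall fun x => sq_nonneg _)]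
  exact hfatou.trans_lt ENNReal.ofReal_lt_top

/-- First two moments of an inverse Gaussian law. -/
theorem moments_of_charFun_eq_igExponent {μ : Measure ℝ} [IsProbabilityMeasure μ] {a b : ℝ}
    (hb : 0 < b) (t : ℝ) (h : ∀ θ, charFun μ θ = Complex.exp (t * igExponent a b θ)) :
    MemLp id 2 μ ∧ ∫ x, x ∂μ = t * (a / b) ∧
      ∫ x, x ^ 2 ∂μ = t * (a / b ^ 3) + (t * (a / b)) ^ 2 := by
  set φ : ℝ → ℂ := fun θ => Complex.exp (t * igExponent a b θ) with hφ
  set ψ₁ : ℝ → ℂ := fun θ => a * Complex.I *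
    (-2 * Complex.I * (θ : ℂ) + (b : ℂ) ^ 2) ^ (-(1 / 2) : ℂ) with hψ₁
  set ψ₂ : ℝ → ℂ := fun θ => -a *
    (-2 * Complex.I * (θ : ℂ) + (b : ℂ) ^ 2) ^ (-(3 / 2) : ℂ) with hψ₂
  have d₀ : ∀ θ, HasDerivAt (igExponent a b) (ψ₁ θ) θ := hasDerivAt_igExponent a hb
  have d₁ : ∀ θ, HasDerivAt ψ₁ (ψ₂ θ) θ := hasDerivAt_deriv_igExponent a hb
  have e₁ : ∀ θ, HasDerivAt φ (φ θ * (t * ψ₁ θ)) θ := fun θ =>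
    ((d₀ θ).const_mul (t : ℂ)).cexp
  have c₀ : Continuous φ := continuous_iff_continuousAt.2 fun x => (e₁ x).continuousAt
  have c₁ : Continuous ψ₁ := continuous_iff_continuousAt.2 fun x => (d₁ x).continuousAt
  have c₂ : Continuous ψ₂ := (continuous_igBase_cpow hb _).const_mul _
  have e₂ : ∀ θ, HasDerivAt (fun θ => φ θ * (t * ψ₁ θ))
      (φ θ * (t * ψ₁ θ) * (t * ψ₁ θ) + φ θ * (t * ψ₂ θ)) θ := fun θ =>
    (e₁ θ).mul ((d₁ θ).const_mul (t : ℂ))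
  obtain ⟨hC, h1, h2⟩ := contDiff_two_of_hasDerivAt e₁ e₂ (by fun_prop)
  have hcf : charFun μ = φ := funext h
  have hm : MemLp id 2 μ := memLp_two_of_contDiff_charFun (hcf ▸ hC)
  have i1 := iteratedDeriv_charFun_zero (n := 1) (μ := μ) (hm.mono_exponent (by norm_num))
  have i2 := iteratedDeriv_charFun_zero (n := 2) (μ := μ) (by exact_mod_cast hm)
  rw [hcf, iteratedDeriv_one, h1] at i1
  rw [hcf, h2] at i2
  have v0 : φ 0 = 1 := by simp [hφ, igExponent_zero a hb]
  have v1 : ψ₁ 0 = a * Complex.I * (1 / b) := by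
    simp only [hψ₁, igBase_zero_cpow_neg_half hb]
  have v2 : ψ₂ 0 = -a * (1 / b ^ 3) := by
    simp only [hψ₂, igBase_zero_cpow_neg_three_half hb]
  simp only [v0, v1, v2, pow_one] at i1 i2
  refine ⟨hm, ?_, ?_⟩
  · have : ((∫ x, x ∂μ : ℝ) : ℂ) = ((t * (a / b) : ℝ) : ℂ) := by
      apply mul_left_cancel₀ Complex.I_ne_zero
      rw [← i1]; push_cast; ring
    exact_mod_cast this
  · have : ((∫ x, x ^ 2 ∂μ : ℝ) : ℂ) = ((t * (a / b ^ 3) + (t * (a / b)) ^ 2 : ℝ) : ℂ) := by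
      rw [Complex.I_sq] at i2
      push_cast at i2 ⊢
      linear_combination i2 - (t * (a : ℂ) / b) ^ 2 * Complex.I_sq
    exact_mod_cast this

/-! ### Ornstein-Uhlenbeck paths and joint measurability -/

/-- The integral of a path solving an Ornstein-Uhlenbeck equation, in terms of its driving path. -/
theorem integral_ouPath {lam x0 : ℝ} {X L : ℝ → ℝ}
    (hL : ∀ s, 0 < s → ContinuousWithinAt L (Set.Ici s) s)
    (hint : ∀ t, 0 ≤ t → IntervalIntegrable X volume 0 t)
    (heq : ∀ t, 0 ≤ t → X t = x0 - lam * (∫ s in (0 : ℝ)..t, X s) + L t) {t : ℝ} (ht : 0 ≤ t) :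
    ∫ s in (0 : ℝ)..t, X s = ∫ s in (0 : ℝ)..t, Real.exp (-(lam * t) + lam * s) * (x0 + L s) := by
  set Y : ℝ → ℝ := fun t => ∫ s in (0 : ℝ)..t, X s with hY
  have hYc : ∀ T, 0 ≤ T → ContinuousOn Y (Set.Icc 0 T) := fun T hT => by
    have := intervalIntegral.continuousOn_primitive_interval' (hint T hT) Set.left_mem_uIcc
    rwa [Set.uIcc_of_le hT] at this
  -- By the equation, `X` is the right-continuous `L` plus a continuous function; hence its
  -- primitive `Y` has right derivative `X` everywhere inside the interval, even at jumps.
  have hXr : ∀ s, 0 < s → ContinuousWithinAt X (Set.Ioi s) s := fun s hs => by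
    have h1 : ContinuousWithinAt Y (Set.Ioi s) s :=
      ((hYc (s + 1) (by linarith)).continuousAt
        (Icc_mem_nhds hs (by linarith))).continuousWithinAt
    have h2 := (hL s hs).mono Set.Ioi_subset_Ici_self
    refine ((continuousWithinAt_const (b := x0)).sub (h1.const_mul lam)).add h2 |>.congr ?_ ?_
    · intro y hy
      exact heq y (hs.le.trans (le_of_lt hy))
    · exact heq s hs.le
  have hYd : ∀ s ∈ Set.Ioo 0 t, HasDerivWithinAt Y (X s) (Set.Ioi s) s := fun s hs => by
    refine (intervalIntegral.integral_hasDerivWithinAt_right (s := Set.Ici s) (t := Set.Ioi s)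
      (hint s hs.1.le) ?_ (hXr s hs.1)).mono Set.Ioi_subset_Ici_self
    refine ⟨Set.Ioc 0 t, mem_nhdsWithin_of_mem_nhds (Ioc_mem_nhds hs.1 hs.2), ?_⟩
    have := (hint t ht).aestronglyMeasurable
    simpa using this
  have hE : ∀ s, HasDerivAt (fun s => Real.exp (-(lam * t) + lam * s))
      (Real.exp (-(lam * t) + lam * s) * lam) s := fun s => by
    simpa using (((hasDerivAt_id s).const_mul lam).const_add (-(lam * t))).exp
  have hEc : Continuous fun s => Real.exp (-(lam * t) + lam * s) := by fun_prop
  have hYi : IntervalIntegrable Y volume 0 t :=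
    (by rw [Set.uIcc_of_le ht]; exact hYc t ht : ContinuousOn Y (Set.uIcc 0 t)).intervalIntegrable
  -- The right derivative of `exp(lam s) Y` is `exp(lam s) (lam Y + X)`, and `lam Y + X = x0 + L` by
  -- the equation.
  have key := intervalIntegral.integral_eq_sub_of_hasDeriv_right_of_le ht
    (f := fun s => Real.exp (-(lam * t) + lam * s) * Y s)
    (f' := fun s => Real.exp (-(lam * t) + lam * s) * lam * Y s
      + Real.exp (-(lam * t) + lam * s) * X s)
    (hEc.continuousOn.mul (hYc t ht))
    (fun s hs => (hE s).hasDerivWithinAt.mul (hYd s hs))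
    (((hYi.const_mul lam).continuousOn_mul hEc.continuousOn).congr (by
      intro s _; simp only; ring) |>.add ((hint t ht).continuousOn_mul hEc.continuousOn))
  have h0 : Y 0 = 0 := by simp [hY]
  simp only [neg_add_cancel, Real.exp_zero, one_mul, h0, mul_zero, sub_zero] at key
  change Y t = _
  rw [← key]
  refine intervalIntegral.integral_congr fun s hs => ?_
  rw [Set.uIcc_of_le ht] at hs
  simp only [heq s hs.1, hY]
  ring

/-- A family of random variables with right-continuous paths is jointly measurable. -/
theorem measurable_uncurry_of_rightContinuous {Ω : Type*} [MeasurableSpace Ω] {f : ℝ → Ω → ℝ}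
    (hm : ∀ s, Measurable (f s))
    (hc : ∀ ω s, ContinuousWithinAt (fun s => f s ω) (Set.Ici s) s) :
    Measurable (Function.uncurry f) := by
  -- The grid point of mesh `1 / (n + 1)` strictly to the right of `s`. It takes countably many
  -- values and tends to `s` from the right, where right continuity applies.
  set τ : ℕ → ℝ → ℝ := fun n s => ((⌊s * (n + 1)⌋ : ℝ) + 1) / (n + 1) with hτ
  have hlt : ∀ n s, s < τ n s := fun n s => by
    have : (0 : ℝ) < n + 1 := by positivity
    rw [hτ, lt_div_iff₀ this]
    exact Int.lt_floor_add_one _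
  have hle : ∀ n s, τ n s ≤ s + 1 / ((n : ℝ) + 1) := fun n s => by
    have : (0 : ℝ) < n + 1 := by positivity
    rw [hτ, div_le_iff₀ this, add_mul, one_div_mul_cancel this.ne']
    linarith [Int.floor_le (s * (n + 1))]
  refine measurable_of_tendsto_metrizable (f := fun n (p : ℝ × Ω) => f (τ n p.1) p.2) ?_ ?_
  · intro n
    have h1 : Measurable fun p : ℤ × Ω => f (((p.1 : ℝ) + 1) / (n + 1)) p.2 :=
      measurable_from_prod_countable_right fun k => hm (((k : ℝ) + 1) / (n + 1))
    have h2 : Measurable fun p : ℝ × Ω => (⌊p.1 * ((n : ℝ) + 1)⌋, p.2) := by fun_prop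
    exact h1.comp h2
  · rw [tendsto_pi_nhds]
    rintro ⟨s, ω⟩
    refine (hc ω s).tendsto.comp (tendsto_nhdsWithin_iff.2 ⟨?_, ?_⟩)
    · refine tendsto_of_tendsto_of_tendsto_of_le_of_le tendsto_const_nhds
        (?_ : Tendsto (fun n : ℕ => s + 1 / ((n : ℝ) + 1)) atTop (𝓝 s))
        (fun n => (hlt n s).le) (fun n => hle n s)
      simpa using tendsto_one_div_add_atTop_nhds_zero_nat.const_add s
    · exact Eventually.of_forall fun n => (hlt n s).le

theorem covariance_congr_ae {Ω : Type*} [MeasurableSpace Ω] {Q : Measure Ω}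
    {X X' Y Y' : Ω → ℝ} (hX : X =ᵐ[Q] X') (hY : Y =ᵐ[Q] Y') :
    cov[X, Y; Q] = cov[X', Y'; Q] := by
  simp only [covariance, integral_congr_ae hX, integral_congr_ae hY]
  apply integral_congr_ae
  filter_upwards [hX, hY] with ω h1 h2
  rw [h1, h2]

/-! ### Versions, moments and covariances of the subordinator -/

section Levy

variable {Ω : Type*} [MeasurableSpace Ω] {Q : Measure Ω}

/-- The time-changed subordinator has a jointly measurable version with nonnegative nondecreasing
paths. -/
theorem IsIGSubordinator.exists_version {a b lam : ℝ} {Z : ℝ≥0 → Ω → ℝ}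
    (hZ : IsIGSubordinator a b Z Q) (hlam : 0 < lam) :
    ∃ M : ℝ → Ω → ℝ, Measurable (Function.uncurry M) ∧ (∀ ω, Monotone fun s => M s ω) ∧
      (∀ s ω, 0 ≤ M s ω) ∧ (∀ ω s, ContinuousWithinAt (fun s => M s ω) (Set.Ici s) s) ∧
      ∀ᵐ ω ∂Q, ∀ s, M s ω = Z (lam * s).toNNReal ω - Z 0 ω := by
  classical
  have hmt : Monotone fun s : ℝ => (lam * s).toNNReal :=
    fun x y h =>
    Real.toNNReal_mono (mul_le_mul_of_nonneg_left h hlam.le)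
  have hae : ∀ᵐ ω ∂Q, Monotone (fun t => Z t ω) ∧ IsCadlagPath fun t => Z t ω :=
    hZ.mono.and hZ.cadlag
  -- The set of bad paths need not be measurable; setting the process to zero on a measurable null
  -- set containing it keeps the version measurable.
  obtain ⟨N, hN, hNm, hN0⟩ := exists_measurable_superset_of_null (ae_iff.1 hae)
  have hgood : ∀ ω, ω ∉ N → Monotone (fun t => Z t ω) ∧ IsCadlagPath fun t => Z t ω :=
    fun ω hω => by by_contra h; exact hω (hN h)
  set M : ℝ → Ω → ℝ := fun s ω => if ω ∈ N then 0 else Z (lam * s).toNNReal ω - Z 0 ω with hM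
  have hc : ∀ ω s, ContinuousWithinAt (fun s => M s ω) (Set.Ici s) s := fun ω s => by
    by_cases hω : ω ∈ N
    · simp only [hM, hω, if_true]; exact continuousWithinAt_const
    · simp only [hM, hω, if_false]
      refine ContinuousWithinAt.sub ?_ continuousWithinAt_const
      refine ((hgood ω hω).2 (lam * s).toNNReal).1.comp (f := fun s : ℝ => (lam * s).toNNReal) ?_
        fun y hy => hmt hy
      exact Continuous.continuousWithinAt (by fun_prop)
  refine ⟨M, measurable_uncurry_of_rightContinuous (fun s => ?_) hc, fun ω => ?_, fun s ω => ?_, hc,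
    ?_⟩
  · exact Measurable.ite hNm measurable_const ((hZ.measurable _).sub (hZ.measurable _))
  · by_cases hω : ω ∈ N
    · simp only [hM, hω, if_true]; exact monotone_const
    · simp only [hM, hω, if_false]
      intro x y h
      exact sub_le_sub_right ((hgood ω hω).1 (hmt h)) _
  · by_cases hω : ω ∈ N
    · simp [hM, hω]
    · simp only [hM, hω, if_false]
      exact sub_nonneg.2 ((hgood ω hω).1 zero_le)
  · filter_upwards [measure_eq_zero_iff_ae_notMem.1 hN0] with ω hω s
    simp [hM, hω]

variable [IsProbabilityMeasure Q]

theorem IsIGSubordinator.moments {a b : ℝ} {Z : ℝ≥0 → Ω → ℝ} (hZ : IsIGSubordinator a b Z Q)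
    (hb : 0 < b) (t : ℝ≥0) :
    MemLp (Z t) 2 Q ∧ Q[Z t] = t * (a / b) ∧ Var[Z t; Q] = t * (a / b ^ 3) := by
  have hm := hZ.measurable t
  have : IsProbabilityMeasure (Q.map (Z t)) := Measure.isProbabilityMeasure_map hm.aemeasurable
  obtain ⟨h1, h2, h3⟩ := moments_of_charFun_eq_igExponent hb (t : ℝ) (μ := Q.map (Z t)) (a := a)
    (by intro θ; simpa using hZ.charFun_eq t θ)
  have hL : MemLp (Z t) 2 Q := by
    simpa using (memLp_map_measure_iff (by fun_prop) hm.aemeasurable).1 h1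
  rw [integral_map hm.aemeasurable (by fun_prop)] at h2 h3
  refine ⟨hL, h2, ?_⟩
  rw [variance_eq_sub hL, h2]
  simp only [Pi.pow_apply]
  rw [h3]; ring

/-- The increment `Z t - Z s` is independent of `Z s`, so the covariance is the variance of `Z s`.
-/
theorem IsIGSubordinator.covariance_of_le {a b : ℝ} {Z : ℝ≥0 → Ω → ℝ}
    (hZ : IsIGSubordinator a b Z Q) (hb : 0 < b) {s t : ℝ≥0} (hst : s ≤ t) :
    cov[Z s, Z t; Q] = s * (a / b ^ 3) := by
  obtain ⟨hs, -, hv⟩ := hZ.moments hb s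
  have ht := (hZ.moments hb t).1
  have hi := hZ.indep_increments.indepFun_eval_sub zero_le hst hZ.zero
  have h0 := hi.covariance_eq_zero hs (ht.sub hs)
  rw [covariance_sub_right hs ht hs, covariance_self hs.aemeasurable, hv] at h0
  linarith

theorem IsIGSubordinator.covariance_eq {a b : ℝ} {Z : ℝ≥0 → Ω → ℝ}
    (hZ : IsIGSubordinator a b Z Q) (hb : 0 < b) (s t : ℝ≥0) :
    cov[Z s, Z t; Q] = min (s : ℝ) t * (a / b ^ 3) := by
  rcases le_total s t with h | h
  · rw [hZ.covariance_of_le hb h, min_eq_left (by exact_mod_cast h)]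
  · rw [covariance_comm, hZ.covariance_of_le hb h, min_eq_right (by exact_mod_cast h)]

end Levy

/-! ### Exchanging moments with weighted time integrals -/

section Fubini

variable {Ω : Type*} [MeasurableSpace Ω] {Q : Measure Ω}
  {M : ℝ → Ω → ℝ} {w : ℝ → ℝ} {t : ℝ}

/-- Monotone nonnegative paths give the bound `C t M_t`, where `C` bounds the weight on `[0, t]`. -/
theorem memLp_integral_mul (hM : Measurable (Function.uncurry M))
    (hmono : ∀ ω, Monotone fun s => M s ω) (hnn : ∀ s ω, 0 ≤ M s ω) (hL : ∀ s, MemLp (M s) 2 Q)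
    (hw : Continuous w) (ht : 0 ≤ t) :
    MemLp (fun ω => ∫ s in (0 : ℝ)..t, w s * M s ω) 2 Q := by
  obtain ⟨C, hC⟩ := (isCompact_Icc (a := (0 : ℝ)) (b := t)).exists_bound_of_continuousOn
    hw.continuousOn
  refine MemLp.mono' (g := fun ω => C * t * M t ω) ((hL t).const_mul (C * t)) ?_ ?_
  · simp only [intervalIntegral.integral_of_le ht]
    have : Measurable fun p : Ω × ℝ => w p.2 * M p.2 p.1 :=
      (hw.measurable.comp measurable_snd).mul (hM.comp measurable_swap)
    exact (this.stronglyMeasurable.integral_prod_right').aestronglyMeasurable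
  · refine Eventually.of_forall fun ω => ?_
    have := intervalIntegral.norm_integral_le_of_norm_le_const (a := 0) (b := t)
      (f := fun s => w s * M s ω) (C := C * M t ω) fun s hs => by
        rw [Set.uIoc_of_le ht] at hs
        rw [norm_mul, Real.norm_of_nonneg (hnn s ω)]
        have h1 := hC s ⟨hs.1.le, hs.2⟩
        exact mul_le_mul h1 (hmono ω hs.2) (hnn _ _) ((norm_nonneg _).trans h1)
    rw [sub_zero, abs_of_nonneg ht] at this
    linarith

variable [IsProbabilityMeasure Q]

/-- Fubini with dominating function `C |M_t U|`, integrable by Cauchy-Schwarz. The choice `U = 1`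
gives means; a general `U` gives covariances. -/
theorem integral_integral_mul (hM : Measurable (Function.uncurry M))
    (hmono : ∀ ω, Monotone fun s => M s ω) (hnn : ∀ s ω, 0 ≤ M s ω) (hL : ∀ s, MemLp (M s) 2 Q)
    (hw : Continuous w) (ht : 0 ≤ t) {U : Ω → ℝ} (hU : MemLp U 2 Q) :
    IntervalIntegrable (fun s => w s * ∫ ω, M s ω * U ω ∂Q) volume 0 t ∧
    ∫ ω, (∫ s in (0 : ℝ)..t, w s * M s ω) * U ω ∂Q =
      ∫ s in (0 : ℝ)..t, w s * ∫ ω, M s ω * U ω ∂Q := by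
  obtain ⟨C, hC⟩ := (isCompact_Icc (a := (0 : ℝ)) (b := t)).exists_bound_of_continuousOn
    hw.continuousOn
  have hint : Integrable (Function.uncurry fun (ω : Ω) (s : ℝ) => w s * M s ω * U ω)
      (Q.prod (volume.restrict (Set.Ioc 0 t))) := by
    have hg : Integrable (fun p : Ω × ℝ => C * ‖M t p.1 * U p.1‖)
        (Q.prod (volume.restrict (Set.Ioc 0 t))) :=
      (((hL t).integrable_mul hU).norm.const_mul C).comp_fst _
    refine hg.mono' ?_ ?_
    · have : Measurable fun p : Ω × ℝ => w p.2 * M p.2 p.1 :=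
        (hw.measurable.comp measurable_snd).mul (hM.comp measurable_swap)
      exact this.aestronglyMeasurable.mul (hU.aestronglyMeasurable.comp_fst)
    · filter_upwards [Measure.quasiMeasurePreserving_snd.ae
        (ae_restrict_mem (μ := volume) (measurableSet_Ioc (a := (0 : ℝ)) (b := t)))] with p hp
      simp only [Function.uncurry, norm_mul]
      rw [mul_assoc, Real.norm_of_nonneg (hnn _ _), Real.norm_of_nonneg (hnn _ _)]
      have h1 := hC p.2 ⟨hp.1.le, hp.2⟩
      exact mul_le_mul h1 (mul_le_mul_of_nonneg_right (hmono _ hp.2) (norm_nonneg _))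
        (mul_nonneg (hnn _ _) (norm_nonneg _)) ((norm_nonneg _).trans h1)
  constructor
  · rw [intervalIntegrable_iff_integrableOn_Ioc_of_le ht]
    have := hint.integral_prod_right
    simp only [Function.uncurry, mul_assoc, integral_const_mul] at this
    exact this
  · simp only [intervalIntegral.integral_of_le ht, ← integral_mul_const, ← integral_const_mul]
    rw [integral_integral_swap hint]
    simp only [mul_assoc]

theorem expectation_integral_mul (hM : Measurable (Function.uncurry M))
    (hmono : ∀ ω, Monotone fun s => M s ω) (hnn : ∀ s ω, 0 ≤ M s ω) (hL : ∀ s, MemLp (M s) 2 Q)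
    (hw : Continuous w) (ht : 0 ≤ t) :
    IntervalIntegrable (fun s => w s * Q[M s]) volume 0 t ∧
    ∫ ω, (∫ s in (0 : ℝ)..t, w s * M s ω) ∂Q = ∫ s in (0 : ℝ)..t, w s * Q[M s] := by
  simpa using integral_integral_mul hM hmono hnn hL hw ht (memLp_const (1 : ℝ))

theorem covariance_integral_mul (hM : Measurable (Function.uncurry M))
    (hmono : ∀ ω, Monotone fun s => M s ω) (hnn : ∀ s ω, 0 ≤ M s ω) (hL : ∀ s, MemLp (M s) 2 Q)
    (hw : Continuous w) (ht : 0 ≤ t) {U : Ω → ℝ} (hU : MemLp U 2 Q) :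
    cov[fun ω => ∫ s in (0 : ℝ)..t, w s * M s ω, U; Q] =
      ∫ s in (0 : ℝ)..t, w s * cov[M s, U; Q] := by
  obtain ⟨i1, e1⟩ := integral_integral_mul hM hmono hnn hL hw ht hU
  obtain ⟨i2, e2⟩ := expectation_integral_mul hM hmono hnn hL hw ht
  rw [covariance_eq_sub (memLp_integral_mul hM hmono hnn hL hw ht) hU]
  simp only [Pi.mul_apply]
  rw [e1, e2, ← intervalIntegral.integral_mul_const, ← intervalIntegral.integral_sub i1
    (i2.mul_const _)]
  congr 1; ext s
  rw [covariance_eq_sub (hL s) hU]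
  simp only [Pi.mul_apply]
  ring

end Fubini

/-! ### Explicit exponential integrals -/

theorem integral_exp_mul_linear {lam : ℝ} (hlam : lam ≠ 0) (t : ℝ) :
    ∫ s in (0 : ℝ)..t, Real.exp (-(lam * t) + lam * s) * (lam * s) =
      lam⁻¹ * (lam * t - (1 - Real.exp (-(lam * t)))) := by
  have h : ∀ s ∈ Set.uIcc 0 t, HasDerivAt
      (fun s => Real.exp (-(lam * t) + lam * s) * (s - lam⁻¹))
      (Real.exp (-(lam * t) + lam * s) * (lam * s)) s := fun s _ => by
    convert! (((hasDerivAt_id s).const_mul lam).const_add (-(lam * t))).exp.mul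
      ((hasDerivAt_id s).sub_const lam⁻¹) using 1
    simp only [id]
    field_simp
    ring
  rw [intervalIntegral.integral_eq_sub_of_hasDerivAt h
    (by apply Continuous.intervalIntegrable; fun_prop)]
  simp
  field_simp
  ring

theorem integral_exp_mul_min {lam : ℝ} (hlam : lam ≠ 0) {s t : ℝ} (hs : 0 ≤ s) (hst : s ≤ t) :
    ∫ u in (0 : ℝ)..t, Real.exp (-(lam * t) + lam * u) * (lam * min s u) =
      s - lam⁻¹ * Real.exp (-(lam * t) + lam * s) + lam⁻¹ * Real.exp (-(lam * t)) := by
  have hc : Continuous fun u => Real.exp (-(lam * t) + lam * u) * (lam * min s u) := by fun_prop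
  rw [← intervalIntegral.integral_add_adjacent_intervals (b := s)
    (hc.intervalIntegrable _ _) (hc.intervalIntegrable _ _)]
  have e1 : ∫ u in (0 : ℝ)..s, Real.exp (-(lam * t) + lam * u) * (lam * min s u) =
      Real.exp (-(lam * t) + lam * s) * (s - lam⁻¹) + Real.exp (-(lam * t)) * lam⁻¹ := by
    have : ∫ u in (0 : ℝ)..s, Real.exp (-(lam * t) + lam * u) * (lam * min s u) =
        ∫ u in (0 : ℝ)..s, Real.exp (-(lam * t) + lam * u) * (lam * u) := by
      refine intervalIntegral.integral_congr fun u hu => ?_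
      rw [Set.uIcc_of_le hs] at hu
      simp only [min_eq_right hu.2]
    rw [this, intervalIntegral.integral_eq_sub_of_hasDerivAt
      (f := fun u => Real.exp (-(lam * t) + lam * u) * (u - lam⁻¹)) (fun u _ => by
        convert! (((hasDerivAt_id u).const_mul lam).const_add (-(lam * t))).exp.mul
          ((hasDerivAt_id u).sub_const lam⁻¹) using 1
        simp only [id]
        field_simp
        ring) (by apply Continuous.intervalIntegrable; fun_prop)]
    simp
  have e2 : ∫ u in s..t, Real.exp (-(lam * t) + lam * u) * (lam * min s u) =
      s - s * Real.exp (-(lam * t) + lam * s) := by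
    have : ∫ u in s..t, Real.exp (-(lam * t) + lam * u) * (lam * min s u) =
        ∫ u in s..t, Real.exp (-(lam * t) + lam * u) * (lam * s) := by
      refine intervalIntegral.integral_congr fun u hu => ?_
      rw [Set.uIcc_of_le hst] at hu
      simp only [min_eq_left hu.1]
    rw [this, intervalIntegral.integral_eq_sub_of_hasDerivAt
      (f := fun u => s * Real.exp (-(lam * t) + lam * u)) (fun u _ => by
        convert! ((((hasDerivAt_id u).const_mul lam).const_add (-(lam * t))).exp).const_mul s
          using 1
        simp only [id]
        ring) (by apply Continuous.intervalIntegrable; fun_prop)]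
    simp
  rw [e1, e2]
  ring

/-- Writing `min s u` as the length of `[0, s] ∩ [0, u]` shows why the bracket of `∂²I` appears: the
double integral is `lam ∫₀ᵗ (∫ᵣᵗ exp(-lam (t - s)) ds)² dr`. The computation itself uses
antiderivatives. -/
theorem integral_exp_mul_integral_exp_mul_min {lam : ℝ} (hlam : lam ≠ 0) {t : ℝ} (ht : 0 ≤ t) :
    ∫ s in (0 : ℝ)..t, Real.exp (-(lam * t) + lam * s) *
        ∫ u in (0 : ℝ)..t, Real.exp (-(lam * t) + lam * u) * (lam * min s u) =
      (lam ^ 2)⁻¹ * (lam * t - 2 * (1 - Real.exp (-(lam * t)))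
        + 1 / 2 * (1 - Real.exp (-(2 * (lam * t))))) := by
  have h0 : ∫ s in (0 : ℝ)..t, Real.exp (-(lam * t) + lam * s) *
        ∫ u in (0 : ℝ)..t, Real.exp (-(lam * t) + lam * u) * (lam * min s u) =
      ∫ s in (0 : ℝ)..t, Real.exp (-(lam * t) + lam * s) *
        (s - lam⁻¹ * Real.exp (-(lam * t) + lam * s) + lam⁻¹ * Real.exp (-(lam * t))) := by
    refine intervalIntegral.integral_congr fun s hs => ?_
    rw [Set.uIcc_of_le ht] at hs
    simp only [integral_exp_mul_min hlam hs.1 hs.2]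
  have hE : ∀ s, HasDerivAt (fun s => Real.exp (-(lam * t) + lam * s))
      (Real.exp (-(lam * t) + lam * s) * lam) s := fun s => by
    simpa using (((hasDerivAt_id s).const_mul lam).const_add (-(lam * t))).exp
  rw [h0, intervalIntegral.integral_eq_sub_of_hasDerivAt
    (f := fun s => lam⁻¹ * (Real.exp (-(lam * t) + lam * s) * (s - lam⁻¹))
      - lam⁻¹ * lam⁻¹ * (1 / 2) * Real.exp (-(lam * t) + lam * s) ^ 2
      + lam⁻¹ * lam⁻¹ * Real.exp (-(lam * t)) * Real.exp (-(lam * t) + lam * s)) (fun s _ => by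
        convert! ((((hE s).mul ((hasDerivAt_id s).sub_const lam⁻¹)).const_mul lam⁻¹).sub
          (((hE s).pow 2).const_mul (lam⁻¹ * lam⁻¹ * (1 / 2)))).add
          ((hE s).const_mul (lam⁻¹ * lam⁻¹ * Real.exp (-(lam * t)))) using 1
        simp only [id]
        field_simp
        push_cast
        ring) (by apply Continuous.intervalIntegrable; fun_prop)]
  have : Real.exp (-(2 * (lam * t))) = Real.exp (-(lam * t)) ^ 2 := by
    rw [← Real.exp_nat_mul]; congr 1; push_cast; ring
  rw [this]
  simp
  field_simp
  ring

theorem integral_exp_weight {lam : ℝ} (hlam : lam ≠ 0) (t : ℝ) :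
    ∫ s in (0 : ℝ)..t, Real.exp (-(lam * t) + lam * s) = lam⁻¹ * (1 - Real.exp (-(lam * t))) := by
  rw [intervalIntegral.integral_eq_sub_of_hasDerivAt
    (f := fun s => lam⁻¹ * Real.exp (-(lam * t) + lam * s)) (fun s _ => by
      convert! ((((hasDerivAt_id s).const_mul lam).const_add (-(lam * t))).exp).const_mul lam⁻¹
        using 1
      simp only [id]
      field_simp) (by apply Continuous.intervalIntegrable; fun_prop)]
  simp
  ring

/-! ### Mean and covariance of the integrated factors -/

section Factor

variable {Ω : Type*} [MeasurableSpace Ω] {Q : Measure Ω} [IsProbabilityMeasure Q]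
  {p p' : IGOUParams} {Z X Z' X' : ℝ≥0 → Ω → ℝ}

/-- The integrated factor, in terms of a jointly measurable version of its driving process. -/
theorem exists_integral_factor_eq (hZ : IsIGSubordinator p.a p.b Z Q)
    (hX : IsOUProcess p.lam p.x0 Z X Q) (t : ℝ≥0) :
    ∃ M : ℝ → Ω → ℝ, Measurable (Function.uncurry M) ∧ (∀ ω, Monotone fun s => M s ω) ∧
      (∀ s ω, 0 ≤ M s ω) ∧ (∀ s, M s =ᵐ[Q] Z (p.lam * s).toNNReal) ∧ (∀ s, MemLp (M s) 2 Q) ∧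
      (fun ω => ∫ s in (0 : ℝ)..t, X s.toNNReal ω) =ᵐ[Q] fun ω => p.init t +
        ∫ s in (0 : ℝ)..t, Real.exp (-(p.lam * t) + p.lam * s) * M s ω := by
  obtain ⟨M, hM, hmono, hnn, hc, hae⟩ := hZ.exists_version p.lam_pos
  have hMZ : ∀ s, M s =ᵐ[Q] Z (p.lam * s).toNNReal := fun s => by
    filter_upwards [hae, hZ.zero] with ω h1 h2
    rw [h1, h2, sub_zero]
  refine ⟨M, hM, hmono, hnn, hMZ,
    fun s => (memLp_congr_ae (hMZ s)).2 (hZ.moments p.b_pos _).1, ?_⟩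
  filter_upwards [hae, hX.eqn] with ω h1 h2
  rw [integral_ouPath (lam := p.lam) (x0 := p.x0) (X := fun s => X s.toNNReal ω)
    (L := fun s => M s ω) (fun s _ => hc ω s) (fun s hs => ?_) (fun s hs => ?_) t.coe_nonneg]
  · have hi : IntervalIntegrable (fun s => M s ω) volume 0 t := (hmono ω).intervalIntegrable
    simp only [mul_add]
    rw [intervalIntegral.integral_add (by apply Continuous.intervalIntegrable; fun_prop)
      (hi.continuousOn_mul (by fun_prop)), intervalIntegral.integral_mul_const,
      integral_exp_weight p.lam_pos.ne', IGOUParams.init]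
  · have := (h2 s.toNNReal).1
    rwa [Real.coe_toNNReal _ hs] at this
  · have := (h2 s.toNNReal).2
    rw [Real.coe_toNNReal _ hs] at this
    simp only [this, h1]

theorem memLp_integral_factor (hZ : IsIGSubordinator p.a p.b Z Q)
    (hX : IsOUProcess p.lam p.x0 Z X Q) (t : ℝ≥0) :
    MemLp (fun ω => ∫ s in (0 : ℝ)..t, X s.toNNReal ω) 2 Q := by
  obtain ⟨M, hM, hmono, hnn, -, hL, hY⟩ := exists_integral_factor_eq hZ hX t
  have hw : Continuous fun s => Real.exp (-(p.lam * t) + p.lam * s) := by fun_prop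
  have hV := memLp_integral_mul hM hmono hnn hL hw t.coe_nonneg
  rw [memLp_congr_ae hY]
  exact (memLp_const (p.init t)).add hV

theorem expectation_integral_factor (hZ : IsIGSubordinator p.a p.b Z Q)
    (hX : IsOUProcess p.lam p.x0 Z X Q) (t : ℝ≥0) :
    ((∫ ω, (∫ s in (0 : ℝ)..t, X s.toNNReal ω) ∂Q : ℝ) : ℂ) =
      p.init t - Complex.I * p.D1 t := by
  obtain ⟨M, hM, hmono, hnn, hMZ, hL, hY⟩ := exists_integral_factor_eq hZ hX t
  have hw : Continuous fun s => Real.exp (-(p.lam * t) + p.lam * s) := by fun_prop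
  have he : ∫ s in (0 : ℝ)..t, Real.exp (-(p.lam * t) + p.lam * s) * Q[M s] =
      p.lam⁻¹ * (p.lam * t - (1 - Real.exp (-(p.lam * t)))) * (p.a / p.b) := by
    rw [← integral_exp_mul_linear p.lam_pos.ne', ← intervalIntegral.integral_mul_const]
    refine intervalIntegral.integral_congr fun s hs => ?_
    rw [Set.uIcc_of_le t.coe_nonneg] at hs
    rw [integral_congr_ae (hMZ s), (hZ.moments p.b_pos _).2.1,
      Real.coe_toNNReal _ (mul_nonneg p.lam_pos.le hs.1)]
    ring
  rw [integral_congr_ae hY, integral_add (integrable_const _)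
    ((memLp_integral_mul hM hmono hnn hL hw t.coe_nonneg).integrable one_le_two),
    (expectation_integral_mul hM hmono hnn hL hw t.coe_nonneg).2, he, p.D1_eq]
  have h1 : (p.lam : ℂ) ≠ 0 := by exact_mod_cast p.lam_pos.ne'
  have h2 : (p.b : ℂ) ≠ 0 := by exact_mod_cast p.b_pos.ne'
  simp only [integral_const, probReal_univ, one_smul]
  push_cast
  field_simp
  linear_combination ((p.a : ℂ) * (p.lam * t - (1 - Complex.exp (-(p.lam * t))))) * Complex.I_sq

/-- The constant initial contributions drop out, and the covariance passes through the time integral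
in each argument in turn. -/
theorem covariance_integral_factor (hZ : IsIGSubordinator p.a p.b Z Q)
    (hX : IsOUProcess p.lam p.x0 Z X Q) (hZ' : IsIGSubordinator p'.a p'.b Z' Q)
    (hX' : IsOUProcess p'.lam p'.x0 Z' X' Q) (t : ℝ≥0) :
    cov[fun ω => ∫ s in (0 : ℝ)..t, X s.toNNReal ω, fun ω => ∫ s in (0 : ℝ)..t, X' s.toNNReal ω; Q]
      = ∫ s in (0 : ℝ)..t, Real.exp (-(p.lam * t) + p.lam * s) *
          ∫ u in (0 : ℝ)..t, Real.exp (-(p'.lam * t) + p'.lam * u) *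
            cov[Z (p.lam * s).toNNReal, Z' (p'.lam * u).toNNReal; Q] := by
  obtain ⟨M, hM, hmono, hnn, hMZ, hL, hY⟩ := exists_integral_factor_eq hZ hX t
  obtain ⟨M', hM', hmono', hnn', hMZ', hL', hY'⟩ := exists_integral_factor_eq hZ' hX' t
  have hw : Continuous fun s => Real.exp (-(p.lam * t) + p.lam * s) := by fun_prop
  have hw' : Continuous fun s => Real.exp (-(p'.lam * t) + p'.lam * s) := by fun_prop
  have hV := memLp_integral_mul hM hmono hnn hL hw t.coe_nonneg
  have hV' := memLp_integral_mul hM' hmono' hnn' hL' hw' t.coe_nonneg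
  rw [covariance_congr_ae hY hY', covariance_const_add_left (hV.integrable one_le_two),
    covariance_const_add_right (hV'.integrable one_le_two),
    covariance_integral_mul hM hmono hnn hL hw t.coe_nonneg hV']
  congr 1; ext s
  rw [covariance_comm, covariance_integral_mul hM' hmono' hnn' hL' hw' t.coe_nonneg (hL s)]
  congr 2; ext u
  rw [covariance_comm, covariance_congr_ae (hMZ s) (hMZ' u)]

theorem covariance_integral_factor_self (hZ : IsIGSubordinator p.a p.b Z Q)
    (hX : IsOUProcess p.lam p.x0 Z X Q) (t : ℝ≥0) :
    ((cov[fun ω => ∫ s in (0 : ℝ)..t, X s.toNNReal ω,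
      fun ω => ∫ s in (0 : ℝ)..t, X s.toNNReal ω; Q] : ℝ) : ℂ) = -p.D2 t := by
  have he : ∫ s in (0 : ℝ)..t, Real.exp (-(p.lam * t) + p.lam * s) *
          ∫ u in (0 : ℝ)..t, Real.exp (-(p.lam * t) + p.lam * u) *
            cov[Z (p.lam * s).toNNReal, Z (p.lam * u).toNNReal; Q] =
      (p.lam ^ 2)⁻¹ * (p.lam * t - 2 * (1 - Real.exp (-(p.lam * t)))
        + 1 / 2 * (1 - Real.exp (-(2 * (p.lam * t))))) * (p.a / p.b ^ 3) := by
    rw [← integral_exp_mul_integral_exp_mul_min p.lam_pos.ne' t.coe_nonneg,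
      ← intervalIntegral.integral_mul_const]
    refine intervalIntegral.integral_congr fun s hs => ?_
    rw [Set.uIcc_of_le t.coe_nonneg] at hs
    rw [mul_assoc, ← intervalIntegral.integral_mul_const]
    congr 1
    refine intervalIntegral.integral_congr fun u hu => ?_
    rw [Set.uIcc_of_le t.coe_nonneg] at hu
    rw [hZ.covariance_eq p.b_pos, Real.coe_toNNReal _ (mul_nonneg p.lam_pos.le hs.1),
      Real.coe_toNNReal _ (mul_nonneg p.lam_pos.le hu.1), ← mul_min_of_nonneg _ _ p.lam_pos.le]
    ring
  rw [covariance_integral_factor hZ hX hZ hX, he, p.D2_eq]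
  have h1 : (p.lam : ℂ) ≠ 0 := by exact_mod_cast p.lam_pos.ne'
  have h2 : (p.b : ℂ) ≠ 0 := by exact_mod_cast p.b_pos.ne'
  push_cast
  field_simp

theorem covariance_integral_factor_of_indep (hZ : IsIGSubordinator p.a p.b Z Q)
    (hX : IsOUProcess p.lam p.x0 Z X Q) (hZ' : IsIGSubordinator p'.a p'.b Z' Q)
    (hX' : IsOUProcess p'.lam p'.x0 Z' X' Q) (hi : ∀ s u, Z s ⟂ᵢ[Q] Z' u) (t : ℝ≥0) :
    cov[fun ω => ∫ s in (0 : ℝ)..t, X s.toNNReal ω,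
      fun ω => ∫ s in (0 : ℝ)..t, X' s.toNNReal ω; Q] = 0 := by
  rw [covariance_integral_factor hZ hX hZ' hX']
  have : ∀ s u, cov[Z s, Z' u; Q] = 0 := fun s u =>
    (hi s u).covariance_eq_zero (hZ.moments p.b_pos s).1 (hZ'.moments p'.b_pos u).1
  simp [this]

end Factor

/-! ### Entries of the integrated covariance -/

/-- The loading of the entry `(j, k)` of the covariance process on each of the four factors. -/
def covLoading (A : Matrix (Fin 2) (Fin 2) ℝ) (j k : Fin 2) : Fin 2 ⊕ Fin 2 → ℝ :=
  Sum.elim (fun l => if j = l ∧ k = l then 1 else 0) (fun l => A j l * A k l)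

theorem covProcess_apply {Ω : Type*} (A : Matrix (Fin 2) (Fin 2) ℝ) (F V : Fin 2 → ℝ≥0 → Ω → ℝ)
    (t : ℝ≥0) (ω : Ω) (j k : Fin 2) :
    covProcess A F V t ω j k = ∑ i, covLoading A j k i * Sum.elim F V i t ω := by
  fin_cases j <;> fin_cases k <;>
    simp [covProcess, covLoading, Matrix.mul_apply, Matrix.diagonal, Fin.sum_univ_two] <;> ring

theorem intCov_ae_eq {Ω : Type*} [MeasurableSpace Ω] {Q : Measure Ω}
    (A : Matrix (Fin 2) (Fin 2) ℝ) {F V : Fin 2 → ℝ≥0 → Ω → ℝ} {t : ℝ≥0}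
    (hint : ∀ i, ∀ᵐ ω ∂Q,
      IntervalIntegrable (fun s : ℝ => Sum.elim F V i s.toNNReal ω) volume 0 t) (j k : Fin 2) :
    intCov A F V t j k =ᵐ[Q] fun ω =>
      ∑ i, covLoading A j k i * ∫ s in (0 : ℝ)..t, Sum.elim F V i s.toNNReal ω := by
  filter_upwards [ae_all_iff.2 hint] with ω hω
  simp only [intCov, covProcess_apply, ← intervalIntegral.integral_const_mul]
  rw [intervalIntegral.integral_finsetSum fun i _ => (hω i).const_mul _]

/-- Moments of linear combinations of uncorrelated square integrable variables. -/
theorem moments_sum_mul_of_uncorrelated {Ω ι : Type*} [MeasurableSpace Ω] {Q : Measure Ω}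
    [IsProbabilityMeasure Q] [Fintype ι] {Y : ι → Ω → ℝ} (hY : ∀ i, MemLp (Y i) 2 Q)
    (h : ∀ i j, i ≠ j → cov[Y i, Y j; Q] = 0) (c d : ι → ℝ) {U W : Ω → ℝ}
    (hU : U =ᵐ[Q] fun ω => ∑ i, c i * Y i ω) (hW : W =ᵐ[Q] fun ω => ∑ i, d i * Y i ω) :
    MemLp U 2 Q ∧ ∫ ω, U ω ∂Q = ∑ i, c i * ∫ ω, Y i ω ∂Q ∧
      ∫ ω, U ω * W ω ∂Q = ∑ i, c i * d i * cov[Y i, Y i; Q] +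
        (∑ i, c i * ∫ ω, Y i ω ∂Q) * ∑ i, d i * ∫ ω, Y i ω ∂Q := by
  have hc : ∀ (c : ι → ℝ) (i : ι), MemLp (fun ω => c i * Y i ω) 2 Q :=
    fun c i => (hY i).const_mul (c i)
  have hm : ∀ (c : ι → ℝ) {U : Ω → ℝ}, (U =ᵐ[Q] fun ω => ∑ i, c i * Y i ω) →
      MemLp U 2 Q ∧ ∫ ω, U ω ∂Q = ∑ i, c i * ∫ ω, Y i ω ∂Q := fun c U hU => by
    refine ⟨(memLp_congr_ae hU).2 (memLp_finsetSum _ fun i _ => hc c i), ?_⟩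
    rw [integral_congr_ae hU, integral_finsetSum _ fun i _ => (hc c i).integrable one_le_two]
    simp only [integral_const_mul]
  obtain ⟨lU, eU⟩ := hm c hU
  obtain ⟨lW, eW⟩ := hm d hW
  refine ⟨lU, eU, ?_⟩
  have hs := covariance_eq_sub lU lW
  rw [covariance_congr_ae hU hW, covariance_fun_sum_fun_sum (hc c) (hc d), eU, eW] at hs
  have : ∀ i, ∑ j, cov[fun ω => c i * Y i ω, fun ω => d j * Y j ω; Q] =
      c i * d i * cov[Y i, Y i; Q] := fun i => by
    -- Only the diagonal term survives, the variables being uncorrelated.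
    rw [Finset.sum_eq_single i (fun j _ hj => by
      rw [covariance_const_mul_left, covariance_const_mul_right, h i j hj.symm]; simp) (by simp),
      covariance_const_mul_left, covariance_const_mul_right]
    ring
  simp only [this, Pi.mul_apply] at hs
  linarith

theorem proposition3p2 {Ω : Type*} [MeasurableSpace Ω] (Q : Measure Ω) [IsProbabilityMeasure Q]
    (pF pV : Fin 2 → IGOUParams)
    (A : Matrix (Fin 2) (Fin 2) ℝ) (hA : A ∈ Matrix.orthogonalGroup (Fin 2) ℝ)
    (ZF ZV F V : Fin 2 → ℝ≥0 → Ω → ℝ)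
    (hZF : ∀ l, IsIGSubordinator (pF l).a (pF l).b (ZF l) Q)
    (hZV : ∀ l, IsIGSubordinator (pV l).a (pV l).b (ZV l) Q)
    (hindep : iIndepFun
      (fun (i : Fin 2 ⊕ Fin 2) (ω : Ω) (t : ℝ≥0) => Sum.elim ZF ZV i t ω) Q)
    (hF : ∀ l, IsOUProcess (pF l).lam (pF l).x0 (ZF l) (F l) Q)
    (hV : ∀ l, IsOUProcess (pV l).lam (pV l).x0 (ZV l) (V l) Q)
    (t : ℝ≥0) :
    -- the derivatives of the functions `I` at zero exist and have the stated values
    (∀ p : IGOUParams, (∃ l, p = pF l ∨ p = pV l) →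
      ContDiffAt ℝ 2 (p.logChf t) 0 ∧
      p.D1 t = Complex.I * p.a / (p.lam * p.b) *
        (p.lam * t - (1 - Real.exp (-(p.lam * t))) : ℝ) ∧
      p.D2 t = -((p.a : ℂ) / (p.lam ^ 2 * p.b ^ 3)) *
        (p.lam * t - 2 * (1 - Real.exp (-(p.lam * t)))
          + 1 / 2 * (1 - Real.exp (-(2 * (p.lam * t)))) : ℝ)) ∧
    -- all the moments below are finite
    (∀ j k, MemLp (intCov A F V t j k) 2 Q) ∧
    -- first moments
    (∀ k, ((∫ ω, intCov A F V t k k ω ∂Q : ℝ) : ℂ) =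
      (pF k).init t - Complex.I * (pF k).D1 t
        + ∑ l, (A k l : ℂ) ^ 2 * (pV l).init t
        - Complex.I * ∑ l, (A k l : ℂ) ^ 2 * (pV l).D1 t) ∧
    ((∫ ω, intCov A F V t 0 1 ω ∂Q : ℝ) : ℂ) =
      ∑ l, (A 0 l : ℂ) * A 1 l * (pV l).init t
        - Complex.I * ∑ l, (A 0 l : ℂ) * A 1 l * (pV l).D1 t ∧
    -- second moments
    (∀ k, ((∫ ω, (intCov A F V t k k ω) ^ 2 ∂Q : ℝ) : ℂ) =
      -(Complex.I * (pF k).init t + (pF k).D1 t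
          + Complex.I * ∑ l, (A k l : ℂ) ^ 2 * (pV l).init t
          + ∑ l, (A k l : ℂ) ^ 2 * (pV l).D1 t) ^ 2
        - ((pF k).D2 t + ∑ l, (A k l : ℂ) ^ 4 * (pV l).D2 t)) ∧
    ((∫ ω, (intCov A F V t 0 1 ω) ^ 2 ∂Q : ℝ) : ℂ) =
      -∑ l, (A 0 l : ℂ) ^ 2 * (A 1 l : ℂ) ^ 2 * (pV l).D2 t
        - (Complex.I * ∑ l, (A 0 l : ℂ) * A 1 l * (pV l).init t
          + ∑ l, (A 0 l : ℂ) * A 1 l * (pV l).D1 t) ^ 2 ∧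
    -- mixed moments
    (∀ k, ((∫ ω, intCov A F V t k k ω * intCov A F V t 0 1 ω ∂Q : ℝ) : ℂ) =
      -∑ l, (A k l : ℂ) ^ 2 * A 0 l * A 1 l * (pV l).D2 t
        - (Complex.I * (pF k).init t + (pF k).D1 t
            + Complex.I * ∑ l, (A k l : ℂ) ^ 2 * (pV l).init t
            + ∑ l, (A k l : ℂ) ^ 2 * (pV l).D1 t)
          * (Complex.I * ∑ l, (A 0 l : ℂ) * A 1 l * (pV l).init t
            + ∑ l, (A 0 l : ℂ) * A 1 l * (pV l).D1 t)) ∧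
    ((∫ ω, intCov A F V t 0 0 ω * intCov A F V t 1 1 ω ∂Q : ℝ) : ℂ) =
      -∑ l, (A 0 l : ℂ) ^ 2 * (A 1 l : ℂ) ^ 2 * (pV l).D2 t
        - (Complex.I * (pF 0).init t + (pF 0).D1 t
            + Complex.I * ∑ l, (A 0 l : ℂ) ^ 2 * (pV l).init t
            + ∑ l, (A 0 l : ℂ) ^ 2 * (pV l).D1 t)
          * (Complex.I * (pF 1).init t + (pF 1).D1 t
            + Complex.I * ∑ l, (A 1 l : ℂ) ^ 2 * (pV l).init t
            + ∑ l, (A 1 l : ℂ) ^ 2 * (pV l).D1 t) := by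
  have hZ : ∀ i, IsIGSubordinator (Sum.elim pF pV i).a (Sum.elim pF pV i).b (Sum.elim ZF ZV i) Q := by
    rintro (l | l)
    exacts [hZF l, hZV l]
  have hX : ∀ i, IsOUProcess (Sum.elim pF pV i).lam (Sum.elim pF pV i).x0 (Sum.elim ZF ZV i)
      (Sum.elim F V i) Q := by
    rintro (l | l)
    exacts [hF l, hV l]
  set Y : Fin 2 ⊕ Fin 2 → Ω → ℝ := fun i ω => ∫ s in (0 : ℝ)..t, Sum.elim F V i s.toNNReal ω with hY
  have hL : ∀ i, MemLp (Y i) 2 Q := fun i => memLp_integral_factor (hZ i) (hX i) t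
  have hE : ∀ i, ((∫ ω, Y i ω ∂Q : ℝ) : ℂ) = (Sum.elim pF pV i).init t
      - Complex.I * (Sum.elim pF pV i).D1 t := fun i =>
    expectation_integral_factor (hZ i) (hX i) t
  have hC : ∀ i, ((cov[Y i, Y i; Q] : ℝ) : ℂ) = -(Sum.elim pF pV i).D2 t := fun i =>
    covariance_integral_factor_self (hZ i) (hX i) t
  -- Independence of the whole paths passes to their values at any two times.
  have h0 : ∀ i j, i ≠ j → cov[Y i, Y j; Q] = 0 := fun i j hij =>
    covariance_integral_factor_of_indep (hZ i) (hX i) (hZ j) (hX j) (fun s u =>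
      (hindep.indepFun hij).comp (measurable_pi_apply s) (measurable_pi_apply u)) t
  have hae : ∀ j k, intCov A F V t j k =ᵐ[Q] fun ω => ∑ i, covLoading A j k i * Y i ω :=
    intCov_ae_eq A fun i => by filter_upwards [(hX i).eqn] with ω hω using (hω t).1
  have hmom := fun j k j' k' => moments_sum_mul_of_uncorrelated hL h0 (covLoading A j k)
    (covLoading A j' k') (hae j k) (hae j' k')
  refine ⟨fun p _ => ⟨(p.contDiff_logChf t).contDiffAt, p.D1_eq t, p.D2_eq t⟩,
    fun j k => (hmom j k j k).1, fun k => ?_, ?_, fun k => ?_, ?_, fun k => ?_, ?_⟩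
  · rw [(hmom k k k k).2.1]
    push_cast
    simp only [hE]
    fin_cases k <;> simp [covLoading, Fin.sum_univ_two] <;> ring
  · rw [(hmom 0 1 0 1).2.1]
    push_cast
    simp only [hE]
    simp [covLoading, Fin.sum_univ_two]
    ring
  -- A mean equals `-i D`, with `D` the corresponding `D_k` or `D₁₂`; hence `i² = -1` turns products
  -- of means into the terms `-D D'`, here and in the cases below.
  · simp only [pow_two (intCov A F V t k k _)]
    rw [(hmom k k k k).2.2]
    push_cast
    simp only [hE, hC]
    fin_cases k <;> simp [covLoading, Fin.sum_univ_two] <;> ring_nf <;>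
      simp only [Complex.I_sq] <;> ring
  · simp only [pow_two (intCov A F V t 0 1 _)]
    rw [(hmom 0 1 0 1).2.2]
    push_cast
    simp only [hE, hC]
    simp [covLoading, Fin.sum_univ_two]
    ring_nf
    simp only [Complex.I_sq]
    ring
  · rw [(hmom k k 0 1).2.2]
    push_cast
    simp only [hE, hC]
    fin_cases k <;> simp [covLoading, Fin.sum_univ_two] <;> ring_nf <;>
      simp only [Complex.I_sq] <;> ring
  · rw [(hmom 0 0 1 1).2.2]
    push_cast
    simp only [hE, hC]
    simp [covLoading, Fin.sum_univ_two]
    ring_nf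
    simp only [Complex.I_sq]
    ring
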